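/- **Notation.** Let $\mathbb O$ be the octonions with standard basis $e_0=1,e_1,\dots,e_7$, conjugation $\bar{\mathbf x}=x_0-\sum_{p\ge1}x_pe_p$, and write points of $\mathbb O^2\cong\mathbb R^{16}$ as $\mathbf x=(\mathbf x_1,\mathbf x_2)$, $\mathbf x_\alpha=\sum_p x_{\alpha p}e_p$, with the Euclidean norm; $B(\mathbf a,r)$ is the open ball. Let $\mathcal H^2(\mathbb O)$ be the $10$-dimensional real space of octonionic Hermitian matrices $A=\begin{pmatrix}a_{\bar11}&a_{\bar12}\\ a_{\bar21}&a_{\bar22}\end{pmatrix}$ ($a_{\bar11},a_{\bar22}\in\mathbb R$, $a_{\bar21}=\overline{a_{\bar12}}\in\mathbb O$), with mixed determinant $$\det(A,B)=\tfrac12\bigl(a_{\bar11}b_{\bar22}+a_{\bar22}b_{\bar11}-2\operatorname{Re}(a_{\bar12}b_{\bar21})\bigr).$$ For a real $C^2$ function $u$ put $Hess_{\mathbb O}(u)=(\bar\partial_\alpha\partial_\beta u)_{\alpha,\beta=1,2}$, where $\bar\partial_\alpha F=\sum_p e_p\,\frac{\partial F}{\partial x_{\alpha p}}$ and $\partial_\beta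 u=\sum_p\frac{\partial u}{\partial x_{\beta p}}\bar e_p$. A *current* on an open set $\Omega\subseteq\mathbb O^2$ is a continuous linear functional $T$ on the space $\mathcal D(\Omega,\mathcal H^2(\mathbb O))$ of smooth compactly supported $\mathcal H^2(\mathbb O)$-valued functions. It is *positive* if $T(\eta)\ge0$ for every $\eta\in\mathcal D(\Omega,\mathcal H^2(\mathbb O))$ all of whose values lie in the convex cone (including $0$) generated by the matrices $\xi\otimes\xi^*=(\xi_\alpha\bar\xi_\beta)$, $\xi\in\mathbb O^2\setminus\{0\}$. An $\mathcal H^2(\mathbb O)$-valued Radon measure $\psi$ on $\Omega$ is identified with the current $\varphi\mapsto\int_\Omega\det(\psi,\varphi)$; by the same pairing every current $T$ has entries $T_{\bar\alpha\beta}$, which are ($\mathbb O$-valued) distributions on $\Omega$. The current $T$ is *closed* if, in the sense of distributions, $$\sum_{p=0}^7\frac{\partial T_{\bar\alpha\beta}}{\partial x_{\beta p}}\,e_p=\sum_{p=0}^7e_p\,\frac{\partial T_{\bar\beta\beta}}{\partial x_{\alpha p}}\qquad\text{for }(\alpha,\beta)=(1,2),(2,1).$$ **Proposition.** Let $\Omega\subseteq\mathbb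 O^2$ be a domain, $\mathbf a\in\Omega$ and $R>0$ with $B(\mathbf a,R)\Subset\Omega$, and let $\omega$ be a closed positive current on $\Omega$. Then $\omega$ is given by an $\mathcal H^2(\mathbb O)$-valued Radon measure on $\Omega$, so that $$\sigma(\mathbf a,r)=\int_{B(\mathbf a,r)}\det\bigl(Hess_{\mathbb O}(|\mathbf x|^2),\omega\bigr),\qquad 0<r<R,$$ is well defined (it depends only on $\omega$, $\mathbf a$ and $r$). The function $r\mapsto\sigma(\mathbf a,r)/r^8$ is increasing (in the non-strict sense) on $(0,R)$. Hence the limit $$\lim_{r\to0+}\frac{\sigma(\mathbf a,r)}{r^8},$$ the octonionic Lelong number of $\omega$ at $\mathbf a$, exists, is finite, and is nonnegative. -/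

import Mathlib

open Set Metric Filter Topology MeasureTheory TopologicalSpace
open scoped Distributions LineDeriv NNReal Quaternion

noncomputable section

namespace OctonionicCurrent

/-! ### Octonions -/

/-- The real vector space `𝕆 = ℝ⁸` of octonions `x = ∑ₚ xₚ eₚ`, with its Euclidean norm. -/
abbrev Octonion : Type := EuclideanSpace ℝ (Fin 8)

namespace Octonion

/-- The basis element `eₚ`; `e 0` is the unit. -/
def e (p : Fin 8) : Octonion := EuclideanSpace.single p 1

/-- Real part. -/
def re (x : Octonion) : ℝ := x 0

/-- Conjugation `x₀ - ∑_{p ≥ 1} xₚ eₚ`. -/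
def conj (x : Octonion) : Octonion :=
  WithLp.toLp 2 fun p => if p = 0 then x p else - x p

/-- First component `a` under the identification `𝕆 = ℍ × ℍ`, `x = (a, b)`. -/
def fst (x : Octonion) : ℍ[ℝ] := ⟨x 0, x 1, x 2, x 3⟩

/-- Second component `b` under the identification `𝕆 = ℍ × ℍ`, `x = (a, b)`. -/
def snd (x : Octonion) : ℍ[ℝ] := ⟨x 4, x 5, x 6, x 7⟩

/-- The octonion with quaternionic components `(a, b)`. -/
def ofPair (a b : ℍ[ℝ]) : Octonion :=
  !₂[a.re, a.imI, a.imJ, a.imK, b.re, b.imI, b.imJ, b.imK]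

/-- Octonionic multiplication: `(a, b)(c, d) = (a c - d̄ b, d a + b c̄)`. -/
def mul (x y : Octonion) : Octonion :=
  ofPair (x.fst * y.fst - star y.snd * x.snd) (y.snd * x.fst + x.snd * star y.fst)

end Octonion

open Octonion

/-- The octonionic plane `𝕆² = ℝ¹⁶`, with the Euclidean norm `|x|² = |x₁|² + |x₂|²`. The real
coordinate `x_{α p}` of `x` is `x (α, p)`; the two octonionic coordinates are indexed by
`Fin 2 = {0, 1}`. -/
abbrev O2 : Type := EuclideanSpace ℝ (Fin 2 × Fin 8)

/-- The octonionic coordinate `x_α = ∑ₚ x_{α p} eₚ` of a point of `𝕆²`. -/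
def O2.coord (x : O2) (α : Fin 2) : Octonion := WithLp.toLp 2 fun p => x (α, p)

/-- The coordinate vector of `𝕆²` in the direction of the real coordinate `x_{α p}`. -/
def coordVec (α : Fin 2) (p : Fin 8) : O2 := EuclideanSpace.single (α, p) 1

/-! ### Octonionic Hermitian matrices -/

/-- The space `ℋ²(𝕆)` of octonionic Hermitian `2 × 2` matrices: the triple `(a, x, b)` stands for
the matrix with rows `(a, x)` and `(x̄, b)`. -/
abbrev Herm : Type := ℝ × Octonion × ℝ

namespace Herm

/-- The entries of an octonionic Hermitian matrix. -/
def toMatrix (A : Herm) : Matrix (Fin 2) (Fin 2) Octonion :=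
  !![A.1 • e 0, A.2.1; conj A.2.1, A.2.2 • e 0]

/-- Mixed determinant `(a₁₁ b₂₂ + a₂₂ b₁₁ - 2 Re (a₁₂ b₂₁)) / 2`. -/
def mixedDet (A B : Herm) : ℝ :=
  (re (A.toMatrix 0 0) * re (B.toMatrix 1 1) + re (A.toMatrix 1 1) * re (B.toMatrix 0 0)
    - 2 * re (mul (A.toMatrix 0 1) (B.toMatrix 1 0))) / 2

/-- The rank one matrix `ξ ⊗ ξ* = (ξ_α ξ̄_β)`. -/
def rankOne (ξ : O2) : Herm :=
  (re (mul (ξ.coord 0) (conj (ξ.coord 0))), mul (ξ.coord 0) (conj (ξ.coord 1)),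
    re (mul (ξ.coord 1) (conj (ξ.coord 1))))

/-- `A` is strongly positive if it lies in the convex cone (with vertex `0` included) generated by
the matrices `ξ ⊗ ξ*`, `ξ ≠ 0`. -/
def StronglyPositive (A : Herm) : Prop :=
  A ∈ Submodule.span ℝ≥0 (rankOne '' {ξ : O2 | ξ ≠ 0})

end Herm

/-! ### Octonionic Hessian -/

/-- Real partial derivative `∂/∂x_{α p}`. -/
def pderiv {E : Type*} [NormedAddCommGroup E] [NormedSpace ℝ E] (α : Fin 2) (p : Fin 8)
    (F : O2 → E) (x : O2) : E :=
  lineDeriv ℝ F x (coordVec α p)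

/-- Dirac operator `∂̄_α F = ∑ₚ eₚ (∂F/∂x_{α p})` on octonion-valued functions. -/
def dirac (α : Fin 2) (F : O2 → Octonion) (x : O2) : Octonion :=
  ∑ p, mul (e p) (pderiv α p F x)

/-- Conjugate Dirac operator `∂_α u = ∑ₚ (∂u/∂x_{α p}) ēₚ` on real-valued functions. -/
def diracConj (α : Fin 2) (u : O2 → ℝ) (x : O2) : Octonion :=
  ∑ p, pderiv α p u x • conj (e p)

/-- Octonionic Hessian `(∂̄_α ∂_β u)` of a real `C²` function (the diagonal entries, which are the
Laplacians in the two octonionic variables, are real). -/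
def hess (u : O2 → ℝ) (x : O2) : Herm :=
  (re (dirac 0 (diracConj 0 u) x), dirac 0 (diracConj 1 u) x, re (dirac 1 (diracConj 1 u) x))

/-! ### Currents -/

/-- A current on `Ω`: a continuous linear functional on the space of smooth compactly supported
`ℋ²(𝕆)`-valued functions on `Ω`. -/
abbrev Current (Ω : Opens O2) : Type := 𝓓(Ω, Herm) →L[ℝ] ℝ

namespace Current

variable {Ω : Opens O2}

/-- `T` is positive if `T η ≥ 0` for every (pointwise) strongly positive test function `η`. -/
def IsPositive (T : Current Ω) : Prop :=
  ∀ η : 𝓓(Ω, Herm), (∀ x, (η x).StronglyPositive) → 0 ≤ T η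

/-- The scalar test function `f` times the constant matrix `A`. -/
def testMul (A : Herm) : 𝓓(Ω, ℝ) →L[ℝ] 𝓓(Ω, Herm) :=
  TestFunction.postcompCLM ((ContinuousLinearMap.id ℝ ℝ).smulRight A)

/-- The octonion-valued distribution `f ↦ T (f A) c`. -/
def coeff (T : Current Ω) (A : Herm) (c : Octonion) : 𝓓'(Ω, Octonion) :=
  ((ContinuousLinearMap.id ℝ ℝ).smulRight c).comp (T.comp (testMul A))

/-- The entries `T_{ᾱβ}` of a current, as octonion-valued distributions. A matrix-valued function
(or measure) `ψ` acts as a current by `φ ↦ ∫ det(ψ, φ)`, so that `ψ₁₁`, `ψ₂₂` and the `p`-th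
coordinate of `ψ₁₂` are recovered by testing against `2 f E₂₂`, `2 f E₁₁` and minus `f` times the
Hermitian matrix with zero diagonal and upper right entry `eₚ`. -/
def entry (T : Current Ω) (α β : Fin 2) : 𝓓'(Ω, Octonion) :=
  !![T.coeff (0, 0, 2) (e 0), - ∑ p, T.coeff (0, e p, 0) (e p);
    - ∑ p, T.coeff (0, e p, 0) (conj (e p)), T.coeff (2, 0, 0) (e 0)] α β

/-- `T` is closed if, in the sense of distributions,
`∑ₚ (∂T_{ᾱβ}/∂x_{β p}) eₚ = ∑ₚ eₚ (∂T_{β̄β}/∂x_{α p})` for `α ≠ β`. -/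
def IsClosed (T : Current Ω) : Prop :=
  ∀ α β : Fin 2, α ≠ β → ∀ f : 𝓓(Ω, ℝ),
    ∑ p, mul ((∂_{coordVec β p} (T.entry α β)) f) (e p)
      = ∑ p, mul (e p) ((∂_{coordVec α p} (T.entry β β)) f)

end Current

/-! ### Matrix-valued Radon measures -/

/-- An `ℋ²(𝕆)`-valued Radon measure `density • base` on `Ω`, in polar form: `base` is a positive
Radon measure on `Ω` and `density` is locally integrable with respect to it. -/
structure HermMeasure (Ω : Opens O2) where
  base : Measure O2
  base_lt_top : ∀ K : Set O2, IsCompact K → K ⊆ Ω → base K < ⊤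
  density : O2 → Herm
  locallyIntegrableOn : LocallyIntegrableOn density (Ω : Set O2) base

namespace HermMeasure

variable {Ω : Opens O2}

/-- The current `T` is given by the matrix-valued measure `W`: `T φ = ∫_Ω det(W, φ)`. -/
def Represents (W : HermMeasure Ω) (T : Current Ω) : Prop :=
  ∀ φ : 𝓓(Ω, Herm), T φ = ∫ x in (Ω : Set O2), Herm.mixedDet (W.density x) (φ x) ∂W.base

/-- `σ(a, r) = ∫_{B(a, r)} det(Hess |x|², W)`. -/
def sigma (W : HermMeasure Ω) (a : O2) (r : ℝ) : ℝ :=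
  ∫ x in ball a r, Herm.mixedDet (hess (fun y => ‖y‖ ^ 2) x) (W.density x) ∂W.base

end HermMeasure

end OctonionicCurrent

end

open OctonionicCurrent

/-! For a strongly positive matrix `A` the functional `f ↦ T (f A)` is a positive distribution,
hence a Radon measure. The space of Hermitian matrices has a basis of strongly positive elements, so
these measures, recombined through the basis dual for the mixed determinant, represent the whole
current (`IsPositive.exists_represents`).

For monotonicity write `y = x - a` and let `I` be the identity matrix. Testing the closedness
equations on the components of the field `χ(|y|²) y` and adding them gives `T(4 χ I + χ' y ⊗ y*) =
0` (`IsClosed.radial_identity`). The matrix `|y|² I - y ⊗ y*` is strongly positive, because octonion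
norms are multiplicative. So if `χ' ≤ 0`, positivity of `T` yields `4 T(χ I) ≤ -T(χ' |y|² I)`
(`IsClosed.four_mul_le`).

Take `χ(s) = θ(s / ρ²)`, and let `M(ρ)` be the integral of `θ(|y|² / ρ²)` against the trace of the
measure. The inequality becomes `ρ M'(ρ) ≥ 8 M(ρ)`, so `M(ρ) / ρ⁸` is nondecreasing. Since the
Hessian of `|x|²` is `16 I`, `σ` is eight times the trace mass of the ball. Letting `θ` tend to the
indicator of `s < 1` carries monotonicity over to `σ`. The smoothed masses are values of `T` on
strongly positive test functions, which also makes `σ` nonnegative and independent of the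
representing measure. -/

theorem IsCompact.preimage_val_opens {X : Type*} [TopologicalSpace X] {Ω : Opens X} {K : Set X}
    (hK : IsCompact K) (hKΩ : K ⊆ Ω) : IsCompact ((Subtype.val : Ω → X) ⁻¹' K) := by
  rwa [Subtype.isCompact_iff, image_preimage_eq_of_subset (by simpa using hKΩ)]

/-! ### Positive distributions are Radon measures -/

namespace TestFunction

section PositiveDistribution

open scoped CompactlySupported

variable {E : Type*} [NormedAddCommGroup E] [NormedSpace ℝ E] {Ω : Opens E}

/-- A scalar test function on `Ω` as a compactly supported continuous function on the subtype. -/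
noncomputable def toCompactlySupported : 𝓓(Ω, ℝ) →ₗ[ℝ] C_c(Ω, ℝ) where
  toFun f :=
    { toFun := fun x => f x
      continuous_toFun := f.continuous.comp continuous_subtype_val
      hasCompactSupport' := by
        refine HasCompactSupport.intro (K := Subtype.val ⁻¹' tsupport f) ?_ ?_
        · exact f.hasCompactSupport.isCompact.preimage_val_opens f.tsupport_subset
        · intro x hx
          exact image_eq_zero_of_notMem_tsupport hx }
  map_add' _ _ := rfl
  map_smul' _ _ := rfl

theorem toCompactlySupported_injective :
    Function.Injective (toCompactlySupported : 𝓓(Ω, ℝ) →ₗ[ℝ] C_c(Ω, ℝ)) := by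
  intro f g h
  ext x
  by_cases hx : x ∈ Ω
  · exact DFunLike.congr_fun h (⟨x, hx⟩ : Ω)
  · rw [image_eq_zero_of_notMem_tsupport fun h => hx (f.tsupport_subset h),
      image_eq_zero_of_notMem_tsupport fun h => hx (g.tsupport_subset h)]

variable [FiniteDimensional ℝ E]

/-- A compact subset of `Ω` carries a nonnegative test function which is at least one on it. -/
theorem exists_one_le_on_isCompact {K : Set E} (hK : IsCompact K) (hKΩ : K ⊆ Ω) :
    ∃ f : 𝓓(Ω, ℝ), (∀ x, 0 ≤ f x) ∧ ∀ x ∈ K, f x = 1 := by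
  obtain ⟨V, hV, hKV, hVΩ, hVc⟩ := exists_open_between_and_isCompact_closure hK Ω.isOpen hKΩ
  obtain ⟨f, hf, hfr, hfs, hf1⟩ := exists_contMDiff_support_eq_eq_one_iff (n := (⊤ : ℕ∞))
    (modelWithCornersSelf ℝ E) hV hK.isClosed hKV
  refine ⟨⟨f, hf.contDiff, ?_, ?_⟩, fun x => (hfr ⟨x, rfl⟩).1, fun x hx => (hf1 x).1 hx⟩
  · rwa [HasCompactSupport, tsupport, hfs]
  · rwa [tsupport, hfs]

variable [MeasurableSpace E] [BorelSpace E]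

/-- A positive distribution is a Radon measure. -/
theorem exists_measure_of_nonneg (T : 𝓓(Ω, ℝ) →ₗ[ℝ] ℝ)
    (hT : ∀ f : 𝓓(Ω, ℝ), (∀ x, 0 ≤ f x) → 0 ≤ T f) :
    ∃ μ : Measure E, SigmaFinite μ ∧ (∀ K : Set E, IsCompact K → K ⊆ Ω → μ K < ⊤) ∧
      ∀ f : 𝓓(Ω, ℝ), T f = ∫ x, f x ∂μ := by
  let e := LinearEquiv.ofInjective (toCompactlySupported : 𝓓(Ω, ℝ) →ₗ[ℝ] C_c(Ω, ℝ))
    toCompactlySupported_injective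
  let s : PointedCone ℝ C_c(Ω, ℝ) :=
    { carrier := {g | ∀ x, 0 ≤ g x}
      add_mem' := fun ha hb x => add_nonneg (ha x) (hb x)
      zero_mem' := fun x => le_rfl
      smul_mem' := fun c g hg x => mul_nonneg c.2 (hg x) }
  have hval (f : 𝓓(Ω, ℝ)) : ((e f : _) : C_c(Ω, ℝ)) = toCompactlySupported f := rfl
  -- Test functions form a proper subspace of `C_c(Ω, ℝ)`. M. Riesz's theorem extends `T` from it
  -- positively, which the Riesz–Markov–Kakutani theorem then turns into a measure.
  obtain ⟨g, hg, hgs⟩ := riesz_extension s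
    ⟨LinearMap.range (toCompactlySupported : 𝓓(Ω, ℝ) →ₗ[ℝ] C_c(Ω, ℝ)), T ∘ₗ e.symm.toLinearMap⟩
    (by
      intro x hx
      obtain ⟨f, rfl⟩ := e.surjective x
      change 0 ≤ T (e.symm (e f))
      rw [e.symm_apply_apply]
      refine hT f fun y => ?_
      by_cases hy : y ∈ Ω
      · exact hx ⟨y, hy⟩
      · rw [image_eq_zero_of_notMem_tsupport fun h => hy (f.tsupport_subset h)])
    (by
      intro y
      -- The subspace is cofinal: a cutoff equal to one on the support of `y`, scaled by a bound for
      -- `y`, makes the sum nonnegative.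
      obtain ⟨C, hC⟩ := y.continuous.bounded_above_of_compact_support y.hasCompactSupport
      obtain ⟨f, hf0, hf1⟩ := exists_one_le_on_isCompact (Ω := Ω)
        (y.hasCompactSupport.isCompact.image continuous_subtype_val) (by
          rintro _ ⟨x, -, rfl⟩
          exact x.2)
      refine ⟨e (|C| • f), fun x => ?_⟩
      change 0 ≤ |C| * f x + y x
      by_cases hx : x ∈ tsupport y
      · rw [hf1 _ ⟨x, hx, rfl⟩]
        have : -|C| ≤ y x := (abs_le.1 ((hC x).trans (le_abs_self C))).1
        linarith
      · rw [image_eq_zero_of_notMem_tsupport hx, add_zero]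
        exact mul_nonneg (abs_nonneg _) (hf0 _))
  have hgT (f : 𝓓(Ω, ℝ)) : g (toCompactlySupported f) = T f := by
    have := hg (e f)
    rw [hval] at this
    rw [this]
    change T (e.symm (e f)) = T f
    rw [e.symm_apply_apply]
  let Λ : C_c(Ω, ℝ) →ₚ[ℝ] ℝ := PositiveLinearMap.mk₀ g fun f hf => hgs f fun x => hf x
  have hΩm : MeasurableEmbedding (Subtype.val : Ω → E) :=
    MeasurableEmbedding.subtype_coe Ω.isOpen.measurableSet
  have : LocallyCompactSpace Ω := Ω.isOpen.locallyCompactSpace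
  refine ⟨(RealRMK.rieszMeasure Λ).map Subtype.val, hΩm.sigmaFinite_map, ?_, ?_⟩
  · intro K hK hKΩ
    rw [hΩm.map_apply]
    exact (hK.preimage_val_opens hKΩ).measure_lt_top
  · intro f
    rw [hΩm.integral_map, ← hgT]
    exact (RealRMK.integral_rieszMeasure Λ (toCompactlySupported f)).symm

end PositiveDistribution

end TestFunction

/-! ### Octonion identities in coordinates -/

namespace OctonionicCurrent

namespace Octonion

theorem mul_coords (x y : Octonion) :
    mul x y = !₂[x 0 * y 0 - x 1 * y 1 - x 2 * y 2 - x 3 * y 3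
        - x 4 * y 4 - x 5 * y 5 - x 6 * y 6 - x 7 * y 7,
      x 0 * y 1 + x 1 * y 0 + x 2 * y 3 - x 3 * y 2
        + x 4 * y 5 - x 5 * y 4 - x 6 * y 7 + x 7 * y 6,
      x 0 * y 2 - x 1 * y 3 + x 2 * y 0 + x 3 * y 1
        + x 4 * y 6 - x 6 * y 4 - x 7 * y 5 + x 5 * y 7,
      x 0 * y 3 + x 1 * y 2 - x 2 * y 1 + x 3 * y 0
        + x 4 * y 7 - x 7 * y 4 - x 5 * y 6 + x 6 * y 5,
      x 0 * y 4 + x 4 * y 0 - x 1 * y 5 + x 5 * y 1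
        - x 2 * y 6 + x 6 * y 2 - x 3 * y 7 + x 7 * y 3,
      x 0 * y 5 + x 5 * y 0 + x 1 * y 4 - x 4 * y 1
        - x 2 * y 7 + x 7 * y 2 + x 3 * y 6 - x 6 * y 3,
      x 0 * y 6 + x 6 * y 0 + x 2 * y 4 - x 4 * y 2
        - x 3 * y 5 + x 5 * y 3 + x 1 * y 7 - x 7 * y 1,
      x 0 * y 7 + x 7 * y 0 + x 3 * y 4 - x 4 * y 3
        - x 1 * y 6 + x 6 * y 1 + x 2 * y 5 - x 5 * y 2] := by
  ext i
  fin_cases i <;> simp [mul, ofPair] <;> simp [fst, snd] <;> ring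

/-- Right multiplication by a fixed octonion, as a linear map. -/
noncomputable def mulRight (y : Octonion) : Octonion →ₗ[ℝ] Octonion where
  toFun x := mul x y
  map_add' a b := by
    ext i
    fin_cases i <;> simp [mul_coords] <;> ring
  map_smul' c a := by
    ext i
    fin_cases i <;> simp [mul_coords] <;> ring

theorem mul_sum_smul_left {ι : Type*} (s : Finset ι) (c : ι → ℝ) (x : ι → Octonion)
    (y : Octonion) : mul (∑ i ∈ s, c i • x i) y = ∑ i ∈ s, c i • mul (x i) y := by
  exact (map_sum (mulRight y) (fun i => c i • x i) s).trans
    (Finset.sum_congr rfl fun i _ => map_smul (mulRight y) (c i) (x i))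

theorem mul_smul_one (x : Octonion) (c : ℝ) : mul x (c • e 0) = c • x := by
  ext i
  fin_cases i <;> simp [mul_coords, e] <;> ring

theorem smul_one_mul (x : Octonion) (c : ℝ) : mul (c • e 0) x = c • x := by
  ext i
  fin_cases i <;> simp [mul_coords, e]

theorem mul_zero_right (x : Octonion) : mul x 0 = 0 := by
  ext i
  fin_cases i <;> simp [mul_coords]

theorem mul_zero_left (x : Octonion) : mul 0 x = 0 := by
  ext i
  fin_cases i <;> simp [mul_coords]

theorem conj_conj (x : Octonion) : conj (conj x) = x := by
  ext i
  fin_cases i <;> simp [conj]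

theorem conj_smul (c : ℝ) (x : Octonion) : conj (c • x) = c • conj x := by
  ext i
  fin_cases i <;> simp [conj]

theorem re_mul_conj (x y : Octonion) : re (mul x (conj y)) = ∑ p, x p * y p := by
  simp [mul_coords, re, conj, Fin.sum_univ_eight]

/-- `⟨u, eₜ v⟩` is the `t`-th coordinate of `u v̄`. -/
theorem sum_mul_basis (u v : Octonion) (t : Fin 8) :
    ∑ p, ∑ q, mul (e t) (e q) p * (u p * v q) = mul u (conj v) t := by
  fin_cases t <;> simp [mul_coords, e, conj, Fin.sum_univ_eight] <;> ring

/-- `⟨v, ēₜ u⟩` is the `t`-th coordinate of `u v̄`. -/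
theorem sum_conj_mul_basis (u v : Octonion) (t : Fin 8) :
    ∑ p, ∑ q, mul (conj (e t)) (e q) p * (v p * u q) = mul u (conj v) t := by
  fin_cases t <;> simp [mul_coords, e, conj, Fin.sum_univ_eight] <;> ring

/-- This is the composition property `|u v̄|² = |u|² |v|²`. It makes the determinant of `ξ ⊗ ξ*`
vanish. -/
theorem norm_sq_mul_conj (u v : Octonion) :
    ∑ t, mul u (conj v) t ^ 2 = (∑ p, u p ^ 2) * ∑ p, v p ^ 2 := by
  simp [mul_coords, conj, Fin.sum_univ_eight]
  ring

end Octonion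

open Octonion

/-! ### The cone of strongly positive matrices -/

namespace Herm

theorem mixedDet_eq (A B : Herm) :
    mixedDet A B = (A.1 * B.2.2 + A.2.2 * B.1 - 2 * ∑ p, A.2.1 p * B.2.1 p) / 2 := by
  rw [← re_mul_conj]
  simp [mixedDet, toMatrix, re, e]

theorem rankOne_eq (ξ : O2) : rankOne ξ = (∑ p, ξ (0, p) ^ 2,
    mul (ξ.coord 0) (conj (ξ.coord 1)), ∑ p, ξ (1, p) ^ 2) := by
  simp [rankOne, re_mul_conj, O2.coord, sq]

/-- The point of `𝕆²` with octonionic coordinates `x` and `y`. -/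
noncomputable def pair (x y : Octonion) : O2 := WithLp.toLp 2 fun i => ![x, y] i.1 i.2

theorem rankOne_pair (x y : Octonion) :
    rankOne (pair x y) = (∑ p, x p ^ 2, mul x (conj y), ∑ p, y p ^ 2) := by
  rw [rankOne_eq]
  rfl

theorem StronglyPositive.add {A B : Herm} (hA : A.StronglyPositive) (hB : B.StronglyPositive) :
    (A + B).StronglyPositive := Submodule.add_mem _ hA hB

theorem StronglyPositive.zero : (0 : Herm).StronglyPositive := Submodule.zero_mem _

theorem StronglyPositive.smul {A : Herm} (hA : A.StronglyPositive) {c : ℝ} (hc : 0 ≤ c) :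
    (c • A).StronglyPositive := Submodule.smul_mem _ (⟨c, hc⟩ : ℝ≥0) hA

theorem stronglyPositive_rankOne (ξ : O2) : (rankOne ξ).StronglyPositive := by
  by_cases h : ξ = 0
  · subst h
    have : rankOne 0 = 0 := by
      have : (0 : O2).coord 0 = 0 := rfl
      simp [rankOne_eq, this, mul_zero_left]
    rw [this]
    exact .zero
  · exact Submodule.subset_span ⟨ξ, h, rfl⟩

/-- A Hermitian matrix with nonnegative diagonal and determinant is strongly positive. -/
theorem stronglyPositive_of_sq_le {a b : ℝ} {y : Octonion} (ha : 0 ≤ a) (hb : 0 ≤ b)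
    (h : ∑ p, y p ^ 2 ≤ a * b) : StronglyPositive (a, y, b) := by
  have hcorner (c : ℝ) (hc : 0 ≤ c) : StronglyPositive (0, 0, c) := by
    have := stronglyPositive_rankOne (pair 0 (√c • e 0))
    rw [rankOne_pair] at this
    simpa [mul_zero_left, e, Fin.sum_univ_eight, Real.sq_sqrt hc] using this
  rcases ha.eq_or_lt with rfl | ha'
  · have hy : y = 0 := by
      ext p
      have := (Finset.sum_eq_zero_iff_of_nonneg fun p _ => sq_nonneg (y p)).1
        (le_antisymm (by simpa using h) (Finset.sum_nonneg fun p _ => sq_nonneg (y p))) p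
        (Finset.mem_univ p)
      simpa using this
    subst hy
    exact hcorner b hb
  -- Completing the square: `ξ = (√a, ȳ / √a)` reproduces the entries `a` and `y`, leaving only the
  -- corner `b - |y|² / a ≥ 0`.
  · have h1 := stronglyPositive_rankOne (pair (√a • e 0) ((√a)⁻¹ • conj y))
    have h2 := hcorner (b - (∑ p, y p ^ 2) / a) (by
      rw [sub_nonneg, div_le_iff₀ ha']
      linarith)
    convert h1.add h2 using 1
    have hs : √a ≠ 0 := (Real.sqrt_pos.2 ha').ne'
    have hconj : ∑ p, conj y p ^ 2 = ∑ p, y p ^ 2 := by simp [conj, Fin.sum_univ_eight]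
    rw [rankOne_pair, conj_smul, conj_conj, smul_one_mul, smul_smul, mul_inv_cancel₀ hs, one_smul]
    ext
    · simp [e, Fin.sum_univ_eight, Real.sq_sqrt ha]
    · simp
    · simp only [PiLp.smul_apply, smul_eq_mul, mul_pow, ← Finset.mul_sum, hconj, inv_pow,
        Real.sq_sqrt ha, Prod.snd_add]
      ring

end Herm

/-! ### The Hessian of the squared norm -/

theorem pderiv_norm_sq (α : Fin 2) (p : Fin 8) (x : O2) :
    pderiv α p (fun y : O2 => ‖y‖ ^ 2) x = 2 * x (α, p) := by
  have := ((hasStrictFDerivAt_norm_sq x).hasFDerivAt.hasLineDerivAt (coordVec α p)).lineDeriv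
  rw [pderiv, this]
  simp [coordVec, EuclideanSpace.inner_single_right]

theorem diracConj_norm_sq (α : Fin 2) (x : O2) :
    diracConj α (fun y : O2 => ‖y‖ ^ 2) x = (2 : ℝ) • conj (x.coord α) := by
  simp only [diracConj, pderiv_norm_sq]
  ext i
  fin_cases i <;> simp [conj, e, O2.coord, Fin.sum_univ_eight]

theorem pderiv_conj_coord (α β : Fin 2) (p : Fin 8) (x : O2) :
    pderiv α p (fun y : O2 => (2 : ℝ) • conj (y.coord β)) x =
      if α = β then (2 : ℝ) • conj (e p) else 0 := by
  let L : O2 →ₗ[ℝ] Octonion :=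
    { toFun := fun y => (2 : ℝ) • conj (y.coord β)
      map_add' := fun y z => by
        ext i
        fin_cases i <;> simp [conj, O2.coord] <;> ring
      map_smul' := fun c y => by
        ext i
        fin_cases i <;> simp [conj, O2.coord] <;> ring }
  have := ((LinearMap.toContinuousLinearMap L).hasFDerivAt (x := x)).hasLineDerivAt
    (coordVec α p)
  refine this.lineDeriv.trans ?_
  change (2 : ℝ) • conj ((coordVec α p).coord β) = _
  split_ifs with h
  · subst h
    congr 2
    ext i
    simp [O2.coord, coordVec, e]
  · ext i
    simp [O2.coord, coordVec, conj, Ne.symm h]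

/-- The octonionic Hessian of `|x|²` is `16` times the identity. -/
theorem hess_norm_sq (x : O2) : hess (fun y => ‖y‖ ^ 2) x = (16, 0, 16) := by
  have h (β : Fin 2) : diracConj β (fun y : O2 => ‖y‖ ^ 2) =
      fun y => (2 : ℝ) • conj (y.coord β) := funext fun y => diracConj_norm_sq β y
  simp only [hess, dirac, h, pderiv_conj_coord]
  simp only [if_true, zero_ne_one, if_false, mul_zero_right, Finset.sum_const_zero]
  have h16 : re (∑ p, mul (e p) ((2 : ℝ) • conj (e p))) = 16 := by
    simp [Fin.sum_univ_eight, mul_coords, e, conj, re]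
    norm_num
  rw [h16]

end OctonionicCurrent

/-! ### Representation of positive currents by matrix-valued measures -/

namespace OctonionicCurrent

open Octonion

namespace Herm

/-- The mixed determinant as a bilinear form. -/
noncomputable def mixedDetLin : Herm →ₗ[ℝ] Herm →ₗ[ℝ] ℝ :=
  LinearMap.mk₂ ℝ mixedDet
    (fun A B C => by simp [mixedDet_eq, add_mul, Finset.sum_add_distrib]; ring)
    (fun c A B => by simp [mixedDet_eq, mul_assoc, ← Finset.mul_sum]; ring)
    (fun A B C => by simp [mixedDet_eq, mul_add, Finset.sum_add_distrib]; ring)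
    (fun c A B => by simp [mixedDet_eq, mul_left_comm _ c, ← Finset.mul_sum]; ring)

theorem mixedDetLin_apply (A B : Herm) : mixedDetLin A B = mixedDet A B := rfl

/-- A basis of the Hermitian matrices consisting of strongly positive ones. -/
noncomputable def posBasis : Option (Option (Fin 8)) → Herm
  | none => (1, 0, 0)
  | some none => (0, 0, 1)
  | some (some p) => (1, e p, 1)

/-- The basis dual to `posBasis` with respect to the mixed determinant. -/
noncomputable def posDualBasis : Option (Option (Fin 8)) → Herm
  | none => (0, ∑ p, e p, 2)
  | some none => (2, ∑ p, e p, 0)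
  | some (some p) => (0, -e p, 0)

theorem stronglyPositive_posBasis (i : Option (Option (Fin 8))) :
    (posBasis i).StronglyPositive := by
  rcases i with _ | _ | p
  · exact stronglyPositive_of_sq_le (by norm_num) (by norm_num) (by simp)
  · exact stronglyPositive_of_sq_le (by norm_num) (by norm_num) (by simp)
  · exact stronglyPositive_of_sq_le (by norm_num) (by norm_num) (by simp [e])

/-- Pairing with the dual basis reads off coordinates, so a test function splits into scalar test
functions times strongly positive constant matrices. -/
theorem sum_mixedDet_posDualBasis_smul (A : Herm) :
    ∑ i, mixedDet (posDualBasis i) A • posBasis i = A := by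
  simp only [Fintype.sum_option, posDualBasis, posBasis, mixedDet_eq]
  ext t
  · simp [e, Fin.sum_univ_eight]
    ring
  · fin_cases t <;> simp [e, Fin.sum_univ_eight]
  · simp [e, Fin.sum_univ_eight]
    ring

end Herm

namespace Current

variable {Ω : Opens O2}

@[simp]
theorem testMul_apply (A : Herm) (f : 𝓓(Ω, ℝ)) (x : O2) : testMul A f x = f x • A := rfl

theorem IsPositive.exists_measure {T : Current Ω} (hT : T.IsPositive) {A : Herm}
    (hA : A.StronglyPositive) :
    ∃ μ : Measure O2, SigmaFinite μ ∧ (∀ K : Set O2, IsCompact K → K ⊆ Ω → μ K < ⊤) ∧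
      ∀ f : 𝓓(Ω, ℝ), T (testMul A f) = ∫ x, f x ∂μ :=
  TestFunction.exists_measure_of_nonneg (T.comp (testMul A)).toLinearMap
    fun _ hf => hT _ fun x => hA.smul (hf x)

/-- A positive current is given by a matrix-valued Radon measure. -/
theorem IsPositive.exists_represents {T : Current Ω} (hT : T.IsPositive) :
    ∃ W : HermMeasure Ω, W.Represents T := by
  choose μ hσ hfin hμ using fun i => hT.exists_measure (Herm.stronglyPositive_posBasis i)
  -- The sum dominates every `μ i`, so all of them have Radon–Nikodym densities against one base
  -- measure.
  let ν : Measure O2 := Measure.sum μ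
  let ρ (i : Option (Option (Fin 8))) (x : O2) : ℝ := ((μ i).rnDeriv ν x).toReal
  have hac (i) : μ i ≪ ν := (Measure.le_sum μ i).absolutelyContinuous
  have hloc (i) : LocallyIntegrableOn (fun _ : O2 => (1 : ℝ)) Ω (μ i) :=
    (locallyIntegrableOn_iff Ω.isOpen.isLocallyClosed).2 fun K hK hKc =>
      integrableOn_const (hfin i K hKc hK).ne
  let W : HermMeasure Ω :=
    { base := ν
      base_lt_top := fun K hK hKΩ => by
        rw [Measure.sum_apply _ hK.measurableSet, tsum_fintype]
        exact ENNReal.sum_lt_top.2 fun i _ => hfin i K hK hKΩ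
      density := fun x => ∑ i, ρ i x • Herm.posDualBasis i
      locallyIntegrableOn := by
        refine (locallyIntegrableOn_iff Ω.isOpen.isLocallyClosed).2 fun K hK hKc => ?_
        exact integrable_finsetSum _ fun i _ =>
          (Measure.integrableOn_toReal_rnDeriv (hfin i K hKc hK).ne).smul_const _ }
  refine ⟨W, fun φ => ?_⟩
  let c (i) : 𝓓(Ω, ℝ) :=
    TestFunction.postcompCLM (LinearMap.toContinuousLinearMap
      (Herm.mixedDetLin (Herm.posDualBasis i))) φ
  have hc (i) (x : O2) : c i x = Herm.mixedDet (Herm.posDualBasis i) (φ x) := rfl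
  have hφ : φ = ∑ i, testMul (Herm.posBasis i) (c i) := by
    ext1 x
    simp [hc, -Fintype.sum_option, Herm.sum_mixedDet_posDualBasis_smul]
  have hint (i) : Integrable (fun x => ρ i x * c i x) ν :=
    (integrable_rnDeriv_smul_iff (hac i)).2 ((c i).integrable (hloc i))
  have hdet (x : O2) : Herm.mixedDet (W.density x) (φ x) = ∑ i, ρ i x * c i x := by
    simp only [W, hc, ← Herm.mixedDetLin_apply, map_sum, map_smul, LinearMap.sum_apply,
      LinearMap.smul_apply, smul_eq_mul]
  rw [setIntegral_eq_integral_of_forall_compl_eq_zero]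
  · simp_rw [hdet]
    rw [integral_finsetSum _ fun i _ => hint i]
    conv_lhs => rw [hφ]
    rw [map_sum]
    refine Finset.sum_congr rfl fun i _ => ?_
    rw [hμ]
    exact (integral_rnDeriv_smul (hac i)).symm
  · intro x hx
    rw [image_eq_zero_of_notMem_tsupport fun h => hx (φ.tsupport_subset h),
      ← Herm.mixedDetLin_apply, map_zero]

end Current

end OctonionicCurrent

/-! ### Radial test functions -/

namespace TestFunction

section Radial

variable {E F : Type*} [NormedAddCommGroup E] [InnerProductSpace ℝ E] [FiniteDimensional ℝ E]
  [NormedAddCommGroup F] [NormedSpace ℝ F] {Ω : Opens E}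

/-- The test function `x ↦ χ(|x - a|²) g(x)`, where `χ` vanishes beyond `ρ²` and the closed ball
of radius `ρ` about `a` lies in `Ω`. -/
noncomputable def radial {a : E} {ρ : ℝ} (hρ : closedBall a ρ ⊆ Ω) (h0 : 0 ≤ ρ) {χ : ℝ → ℝ}
    (hχ : ContDiff ℝ (⊤ : ℕ∞) χ) (hs : ∀ s, ρ ^ 2 < s → χ s = 0) {g : E → F}
    (hg : ContDiff ℝ (⊤ : ℕ∞) g) : 𝓓(Ω, F) :=
  have hsupp : tsupport (fun x => χ (‖x - a‖ ^ 2) • g x) ⊆ closedBall a ρ := by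
    refine closure_minimal (fun x hx => ?_) isClosed_closedBall
    by_contra hxa
    rw [mem_closedBall, dist_eq_norm, not_le] at hxa
    exact hx (by simp only [hs _ (pow_lt_pow_left₀ hxa h0 two_ne_zero), zero_smul])
  ⟨fun x => χ (‖x - a‖ ^ 2) • g x,
    (hχ.comp ((contDiff_id.sub contDiff_const).norm_sq ℝ)).smul hg,
    (isCompact_closedBall a ρ).of_isClosed_subset (isClosed_tsupport _) hsupp, hsupp.trans hρ⟩

variable {a : E} {ρ : ℝ} (hρ : closedBall a ρ ⊆ Ω) (h0 : 0 ≤ ρ) {χ : ℝ → ℝ}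
  (hχ : ContDiff ℝ (⊤ : ℕ∞) χ) (hs : ∀ s, ρ ^ 2 < s → χ s = 0)

theorem radial_apply {g : E → F} (hg : ContDiff ℝ (⊤ : ℕ∞) g) (x : E) :
    radial hρ h0 hχ hs hg x = χ (‖x - a‖ ^ 2) • g x := rfl

theorem lineDeriv_radial {g : E → ℝ} (hg : ContDiff ℝ (⊤ : ℕ∞) g) (v x : E) :
    (∂_{v} (radial hρ h0 hχ hs hg) : 𝓓(Ω, ℝ)) x =
      χ (‖x - a‖ ^ 2) * fderiv ℝ g x v +
        2 * deriv χ (‖x - a‖ ^ 2) * inner ℝ (x - a) v * g x := by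
  rw [lineDerivOp_eq_lineDerivCLM ℝ, lineDerivCLM_apply_of_le le_top]
  have h1 : HasFDerivAt (fun y : E => ‖y - a‖ ^ 2) _ x :=
    ((hasFDerivAt_id x).sub_const a).norm_sq
  have h2 : HasFDerivAt (fun y : E => χ (‖y - a‖ ^ 2)) _ x :=
    ((hχ.differentiable (by simp)) _).hasDerivAt.comp_hasFDerivAt x h1
  have h3 := (h2.mul ((hg.differentiable (by simp)) x).hasFDerivAt).hasLineDerivAt v
  refine h3.lineDeriv.trans ?_
  simp [inner_sub_left]
  ring

theorem deriv_eq_zero_of_forall_lt {χ : ℝ → ℝ} {c : ℝ} (hs : ∀ s, c < s → χ s = 0) (s : ℝ)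
    (h : c < s) : deriv χ s = 0 := by
  have : χ =ᶠ[𝓝 s] fun _ => 0 := by
    filter_upwards [Ioi_mem_nhds h] with t ht using hs t ht
  rw [this.deriv_eq, deriv_const]

end Radial

end TestFunction

/-! ### Closedness tested on the radial field -/

namespace OctonionicCurrent

open Octonion

namespace Current

variable {Ω : Opens O2} {T : Current Ω}

theorem entry_zero_one (h : 𝓓(Ω, ℝ)) :
    T.entry 0 1 h = ∑ s, (-T (testMul (0, e s, 0) h)) • e s := by
  have : T.entry 0 1 h = -((∑ s, T.coeff (0, e s, 0) (e s)) h) := rfl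
  rw [this]
  simp only [neg_smul, Finset.sum_neg_distrib, Fin.sum_univ_eight]
  rfl

theorem entry_one_zero (h : 𝓓(Ω, ℝ)) :
    T.entry 1 0 h = ∑ s, (-T (testMul (0, e s, 0) h)) • conj (e s) := by
  have : T.entry 1 0 h = -((∑ s, T.coeff (0, e s, 0) (conj (e s))) h) := rfl
  rw [this]
  simp only [neg_smul, Finset.sum_neg_distrib, Fin.sum_univ_eight]
  rfl

theorem entry_zero_zero (h : 𝓓(Ω, ℝ)) : T.entry 0 0 h = T (testMul (0, 0, 2) h) • e 0 := rfl

theorem entry_one_one (h : 𝓓(Ω, ℝ)) : T.entry 1 1 h = T (testMul (2, 0, 0) h) • e 0 := rfl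

/-- The minus sign of the off-diagonal pairing cancels the one from integration by parts. The
diagonal entries below keep the latter. -/
theorem lineDeriv_entry_zero_one (v : O2) (g : 𝓓(Ω, ℝ)) :
    (∂_{v} (T.entry 0 1)) g = ∑ s, T (testMul (0, e s, 0) (∂_{v} g)) • e s := by
  rw [Distribution.lineDerivOp_apply_apply, entry_zero_one]
  simp only [map_neg, neg_neg]

theorem lineDeriv_entry_one_zero (v : O2) (g : 𝓓(Ω, ℝ)) :
    (∂_{v} (T.entry 1 0)) g = ∑ s, T (testMul (0, e s, 0) (∂_{v} g)) • conj (e s) := by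
  rw [Distribution.lineDerivOp_apply_apply, entry_one_zero]
  simp only [map_neg, neg_neg]

theorem lineDeriv_entry_zero_zero (v : O2) (g : 𝓓(Ω, ℝ)) :
    (∂_{v} (T.entry 0 0)) g = (-T (testMul (0, 0, 2) (∂_{v} g))) • e 0 := by
  rw [Distribution.lineDerivOp_apply_apply, entry_zero_zero]
  simp only [map_neg]

theorem lineDeriv_entry_one_one (v : O2) (g : 𝓓(Ω, ℝ)) :
    (∂_{v} (T.entry 1 1)) g = (-T (testMul (2, 0, 0) (∂_{v} g))) • e 0 := by
  rw [Distribution.lineDerivOp_apply_apply, entry_one_one]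
  simp only [map_neg]

/-- Taking a single octonionic coordinate of the equation allows a different test function for each
`p`, as needed to insert the components of a vector field. -/
theorem IsClosed.sum_zero_one (hT : T.IsClosed) (g : 𝓓(Ω, ℝ)) (p : Fin 8) :
    T (testMul (2, 0, 0) (∂_{coordVec 0 p} g)) + ∑ q, ∑ s, mul (e s) (e q) p *
      T (testMul (0, e s, 0) (∂_{coordVec 1 q} g)) = 0 := by
  have h := congrArg (fun x : Octonion => x p) (hT 0 1 (by decide) g)
  simp only [lineDeriv_entry_zero_one, lineDeriv_entry_one_one, mul_smul_one,
    mul_sum_smul_left, WithLp.ofLp_sum, WithLp.ofLp_smul, Finset.sum_apply,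
    Pi.smul_apply, smul_eq_mul] at h
  have h2 : ∑ q, -T (testMul (2, 0, 0) (∂_{coordVec 0 q} g)) * e q p =
      -T (testMul (2, 0, 0) (∂_{coordVec 0 p} g)) := by
    simp [e]
  rw [h2] at h
  simp only [mul_comm (T _)] at h
  rw [h, add_neg_cancel]

theorem IsClosed.sum_one_zero (hT : T.IsClosed) (g : 𝓓(Ω, ℝ)) (p : Fin 8) :
    T (testMul (0, 0, 2) (∂_{coordVec 1 p} g)) + ∑ q, ∑ s, mul (conj (e s)) (e q) p *
      T (testMul (0, e s, 0) (∂_{coordVec 0 q} g)) = 0 := by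
  have h := congrArg (fun x : Octonion => x p) (hT 1 0 (by decide) g)
  simp only [lineDeriv_entry_one_zero, lineDeriv_entry_zero_zero, mul_smul_one,
    mul_sum_smul_left, WithLp.ofLp_sum, WithLp.ofLp_smul, Finset.sum_apply,
    Pi.smul_apply, smul_eq_mul] at h
  have h2 : ∑ q, -T (testMul (0, 0, 2) (∂_{coordVec 1 q} g)) * e q p =
      -T (testMul (0, 0, 2) (∂_{coordVec 1 p} g)) := by
    simp [e]
  rw [h2] at h
  simp only [mul_comm (T _)] at h
  rw [h, add_neg_cancel]

theorem e_apply (s t : Fin 8) : e s t = if t = s then 1 else 0 := by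
  simp [e]

theorem _root_.OctonionicCurrent.norm_sq_eq_add (y : O2) :
    ‖y‖ ^ 2 = ∑ p, y (0, p) ^ 2 + ∑ p, y (1, p) ^ 2 := by
  rw [EuclideanSpace.real_norm_sq_eq, Fintype.sum_prod_type, Fin.sum_univ_two]

/-- The difference is the adjugate of `y ⊗ y*`: the diagonal entries are swapped and the
off-diagonal one changes sign. Its determinant vanishes by the composition property. -/
theorem stronglyPositive_norm_sq_sub_rankOne (y : O2) :
    Herm.StronglyPositive (‖y‖ ^ 2 • (1, 0, 1) - Herm.rankOne y) := by
  have h : ‖y‖ ^ 2 • ((1, 0, 1) : Herm) - Herm.rankOne y = (∑ p, y (1, p) ^ 2,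
      -mul (y.coord 0) (conj (y.coord 1)), ∑ p, y (0, p) ^ 2) := by
    rw [Herm.rankOne_eq, norm_sq_eq_add]
    ext <;> simp
  rw [h]
  refine Herm.stronglyPositive_of_sq_le (Finset.sum_nonneg fun p _ => sq_nonneg _)
    (Finset.sum_nonneg fun p _ => sq_nonneg _) ?_
  simp only [WithLp.ofLp_neg, Pi.neg_apply, neg_sq]
  rw [norm_sq_mul_conj, mul_comm]
  rfl

section Radial

variable {a : O2} {ρ : ℝ} (hρ : closedBall a ρ ⊆ Ω) (h0 : 0 ≤ ρ) {χ : ℝ → ℝ}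
  (hχ : ContDiff ℝ (⊤ : ℕ∞) χ) (hs : ∀ s, ρ ^ 2 < s → χ s = 0)

theorem contDiff_coord_sub (a : O2) (i : Fin 2 × Fin 8) :
    ContDiff ℝ (⊤ : ℕ∞) fun x : O2 => (x - a) i := by
  fun_prop

theorem lineDeriv_radial_coord (α β : Fin 2) (p q : Fin 8) (x : O2) :
    (∂_{coordVec β q} (TestFunction.radial hρ h0 hχ hs (contDiff_coord_sub a (α, p))) : 𝓓(Ω, ℝ)) x =
      (if (β, q) = (α, p) then χ (‖x - a‖ ^ 2) else 0) +
        2 * deriv χ (‖x - a‖ ^ 2) * ((x - a) (α, p) * (x - a) (β, q)) := by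
  rw [TestFunction.lineDeriv_radial]
  have h1 : fderiv ℝ (fun x : O2 => (x - a) (α, p)) x (coordVec β q) =
      if (β, q) = (α, p) then 1 else 0 := by
    have := ((EuclideanSpace.proj (𝕜 := ℝ) (α, p) : O2 →L[ℝ] ℝ).hasFDerivAt.comp x
      ((hasFDerivAt_id x).sub_const a)).fderiv
    refine (DFunLike.congr_fun this _).trans ?_
    simp [coordVec, eq_comm]
  have h2 : inner ℝ (x - a) (coordVec β q) = (x - a) (β, q) := by
    simp [coordVec, EuclideanSpace.inner_single_right]
  rw [h1, h2]
  split_ifs <;> ring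

theorem contDiff_rankOne_sub (a : O2) :
    ContDiff ℝ (⊤ : ℕ∞) fun x : O2 => Herm.rankOne (x - a) := by
  simp only [Herm.rankOne_eq]
  refine ContDiff.prodMk (by fun_prop) (ContDiff.prodMk ?_ (by fun_prop))
  refine contDiff_euclidean.2 fun i => ?_
  fin_cases i <;> simp [mul_coords, O2.coord, conj] <;> fun_prop

theorem contDiff_norm_sq_sub_smul (a : O2) (A : Herm) :
    ContDiff ℝ (⊤ : ℕ∞) fun x : O2 => ‖x - a‖ ^ 2 • A :=
  ((contDiff_id.sub contDiff_const).norm_sq ℝ).smul contDiff_const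

/-- The closedness equations tested against the radial vector field `χ(|x - a|²) (x - a)`. -/
theorem IsClosed.radial_identity (hT : T.IsClosed) (hχ' : ContDiff ℝ (⊤ : ℕ∞) (deriv χ))
    (hs' : ∀ s, ρ ^ 2 < s → deriv χ s = 0) :
    4 * T (TestFunction.radial hρ h0 hχ hs (contDiff_const (c := ((1, 0, 1) : Herm)))) +
      T (TestFunction.radial hρ h0 hχ' hs' (contDiff_rankOne_sub a)) = 0 := by
  let G (i : Fin 2 × Fin 8) : 𝓓(Ω, ℝ) :=
    TestFunction.radial hρ h0 hχ hs (contDiff_coord_sub a i)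
  have h1 := Finset.sum_eq_zero fun p (_ : p ∈ Finset.univ) => hT.sum_zero_one (G (0, p)) p
  have h2 := Finset.sum_eq_zero fun p (_ : p ∈ Finset.univ) => hT.sum_one_zero (G (1, p)) p
  simp only [← smul_eq_mul, ← map_smul, ← map_sum, ← map_add] at h1 h2
  have h3 := congrArg₂ (· + ·) h1 h2
  simp only [← map_add] at h3
  obtain ⟨Φ, hΦ, h4⟩ : ∃ Φ, Φ = _ ∧ T Φ = 0 + 0 := ⟨_, rfl, h3⟩
  -- `16` is the `2` of the diagonal test matrices times the eight coordinates of a block; `4` is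
  -- that `2` times the `2` from differentiating `|x - a|²`.
  suffices h : Φ = (16 : ℝ) •
      TestFunction.radial hρ h0 hχ hs (contDiff_const (c := ((1, 0, 1) : Herm))) +
      (4 : ℝ) • TestFunction.radial hρ h0 hχ' hs' (contDiff_rankOne_sub a) by
    rw [h, map_add, map_smul, map_smul, smul_eq_mul, smul_eq_mul] at h4
    linarith
  rw [hΦ]
  ext1 x
  simp only [add_apply, smul_apply, sum_apply,
    TestFunction.radial_apply, testMul_apply, G,
    lineDeriv_radial_coord, Herm.rankOne_eq]
  set k := deriv χ (‖x - a‖ ^ 2)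
  ext t
  · simp only [Prod.fst_add, Prod.smul_fst, Prod.fst_sum,
      smul_eq_mul, mul_zero, mul_one, Finset.sum_const_zero, add_zero, if_true, add_mul,
      Finset.sum_add_distrib, Finset.sum_const, Finset.card_univ, Fintype.card_fin, nsmul_eq_mul,
      Nat.cast_ofNat, Finset.mul_sum]
    congr 1
    · ring
    · refine Finset.sum_congr rfl fun p _ => ?_
      ring
  -- The off-diagonal part mixes derivatives in one block with components in the other, so only `χ'`
  -- terms survive. Each of the two closedness equations contributes `2 χ' y₀ ȳ₁`, where `y = x -
  -- a`.
  · have hZ := sum_mul_basis ((x - a).coord 0) ((x - a).coord 1) t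
    have hZ' := sum_conj_mul_basis ((x - a).coord 0) ((x - a).coord 1) t
    have key (m : Fin 8 → Fin 8 → Fin 8 → ℝ) (u v : Fin 8 → ℝ) :
        ∑ p, ∑ q, ∑ s, m p q s * (2 * k * (u p * v q)) * (if t = s then 1 else 0) =
          2 * k * ∑ p, ∑ q, m p q t * (u p * v q) := by
      simp only [mul_ite, mul_one, mul_zero, Finset.sum_ite_eq, Finset.mem_univ, if_true,
        Finset.mul_sum]
      exact Finset.sum_congr rfl fun p _ => Finset.sum_congr rfl fun q _ => by ring
    simp only [Prod.fst_add, Prod.snd_add, Prod.smul_fst, Prod.smul_snd, Prod.fst_sum,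
      Prod.snd_sum, PiLp.add_apply, PiLp.smul_apply, WithLp.ofLp_sum, Finset.sum_apply, smul_zero,
      smul_eq_mul, zero_add, Prod.mk.injEq, zero_ne_one, one_ne_zero,
      false_and, if_false, e_apply]
    refine ((congrArg₂ (· + ·) (key (fun p q s => mul (e s) (e q) p) _ _)
      (key (fun p q s => mul (conj (e s)) (e q) p) _ _)).trans (congrArg₂ (· + ·)
        (congrArg (2 * k * ·) hZ) (congrArg (2 * k * ·) hZ'))).trans ?_
    ring
  · simp only [Prod.snd_add, Prod.smul_snd, Prod.snd_sum,
      smul_eq_mul, mul_zero, mul_one, Finset.sum_const_zero, add_zero, zero_add, if_true, add_mul,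
      Finset.sum_add_distrib, Finset.sum_const, Finset.card_univ, Fintype.card_fin, nsmul_eq_mul,
      Nat.cast_ofNat, Finset.mul_sum]
    congr 1
    · ring
    · refine Finset.sum_congr rfl fun p _ => ?_
      ring

/-- The differential inequality behind the monotonicity formula. -/
theorem IsClosed.four_mul_le (hT : T.IsClosed) (hpos : T.IsPositive)
    (hχ' : ContDiff ℝ (⊤ : ℕ∞) (deriv χ)) (hs' : ∀ s, ρ ^ 2 < s → deriv χ s = 0)
    (hneg : ∀ s, deriv χ s ≤ 0) :
    4 * T (TestFunction.radial hρ h0 hχ hs (contDiff_const (c := ((1, 0, 1) : Herm)))) ≤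
      -T (TestFunction.radial hρ h0 hχ' hs' (contDiff_norm_sq_sub_smul a (1, 0, 1))) := by
  have h1 := hT.radial_identity hρ h0 hχ hs hχ' hs'
  have h2 := hpos (TestFunction.radial hρ h0 hχ' hs' (contDiff_rankOne_sub a) -
    TestFunction.radial hρ h0 hχ' hs' (contDiff_norm_sq_sub_smul a (1, 0, 1))) fun x => by
      have := (stronglyPositive_norm_sq_sub_rankOne (x - a)).smul
        (neg_nonneg.2 (hneg (‖x - a‖ ^ 2)))
      convert this using 1
      simp only [sub_apply, TestFunction.radial_apply, neg_smul, smul_sub]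
      abel
  rw [map_sub] at h2
  linarith

end Radial

end Current

end OctonionicCurrent

/-! ### Monotonicity of the ball masses -/

namespace OctonionicCurrent

/-- A smooth nonincreasing profile which is `1` up to `1 - 1 / (n + 1)` and `0` beyond `1`. -/
noncomputable def profile (n : ℕ) (s : ℝ) : ℝ := Real.smoothTransition ((n + 1) * (1 - s))

theorem contDiff_profile (n : ℕ) : ContDiff ℝ (⊤ : ℕ∞) (profile n) :=
  Real.smoothTransition.contDiff.comp (contDiff_const.mul (contDiff_const.sub contDiff_id))

theorem profile_eq_zero (n : ℕ) {s : ℝ} (hs : 1 ≤ s) : profile n s = 0 :=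
  Real.smoothTransition.zero_of_nonpos
    (mul_nonpos_of_nonneg_of_nonpos (by positivity) (by linarith))

theorem profile_nonneg (n : ℕ) (s : ℝ) : 0 ≤ profile n s := Real.smoothTransition.nonneg _

theorem profile_le_one (n : ℕ) (s : ℝ) : profile n s ≤ 1 := Real.smoothTransition.le_one _

theorem antitone_profile (n : ℕ) : Antitone (profile n) := fun s t hst =>
  Real.smoothTransition.monotone (mul_le_mul_of_nonneg_left (by linarith) (by positivity))

/-- Every profile vanishes at `s = 1`, so the limit selects the open ball and no sphere has to be a
null set. -/
theorem tendsto_profile (s : ℝ) :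
    Tendsto (fun n => profile n s) atTop (𝓝 (if s < 1 then 1 else 0)) := by
  split_ifs with h
  · refine tendsto_const_nhds.congr' ?_
    obtain ⟨N, hN⟩ := exists_nat_gt (1 / (1 - s))
    filter_upwards [eventually_ge_atTop N] with n hn
    refine (Real.smoothTransition.one_of_one_le ?_).symm
    rw [div_lt_iff₀ (by linarith)] at hN
    have : (N : ℝ) ≤ n := by exact_mod_cast hn
    nlinarith
  · exact tendsto_const_nhds.congr fun n => (profile_eq_zero n (not_lt.1 h)).symm

namespace HermMeasure

variable {Ω : Opens O2} (W : HermMeasure Ω)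

/-- The trace of the density. -/
noncomputable def trace (x : O2) : ℝ := (W.density x).1 + (W.density x).2.2

theorem mixedDet_smul_one (x : O2) (c : ℝ) :
    Herm.mixedDet (W.density x) (c • (1, 0, 1)) = W.trace x * c / 2 := by
  simp [Herm.mixedDet_eq, trace]
  ring

theorem sigma_eq (a : O2) (r : ℝ) : W.sigma a r = 8 * ∫ x in ball a r, W.trace x ∂W.base := by
  rw [sigma, ← integral_const_mul]
  refine integral_congr_ae (.of_forall fun x => ?_)
  simp only [hess_norm_sq, Herm.mixedDet_eq, trace]
  simp
  ring

theorem integrableOn_trace {K : Set O2} (hK : IsCompact K) (hKΩ : K ⊆ Ω) :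
    IntegrableOn W.trace K W.base := by
  have := W.locallyIntegrableOn.integrableOn_compact_subset hKΩ hK
  exact this.fst.add this.snd.snd

variable {W} {T : Current Ω} {a : O2} {ρ R : ℝ}

/-- The domain of integration is a fixed ball, so that later only the integrand depends on the
radius. -/
theorem Represents.apply_smul_one (hW : W.Represents T) (hR : closedBall a R ⊆ Ω) (φ : 𝓓(Ω, Herm))
    (c : O2 → ℝ) (hφ : ∀ x, φ x = c x • (1, 0, 1)) (hc : ∀ x, x ∉ closedBall a R → c x = 0) :
    T φ = (∫ x in closedBall a R, W.trace x * c x ∂W.base) / 2 := by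
  rw [hW, ← integral_div]
  simp_rw [hφ, mixedDet_smul_one]
  refine (setIntegral_eq_of_subset_of_forall_sdiff_eq_zero Ω.isOpen.measurableSet hR ?_)
  intro x hx
  simp [hc x hx.2]

/-- The trace mass of a ball, smoothed with the profile `θ`. -/
noncomputable def smoothMass (W : HermMeasure Ω) (a : O2) (R : ℝ) (θ : ℝ → ℝ) (ρ : ℝ) : ℝ :=
  ∫ x in closedBall a R, W.trace x * θ (‖x - a‖ ^ 2 / ρ ^ 2) ∂W.base

theorem hasDerivAt_smoothMass (hR : closedBall a R ⊆ Ω) {θ : ℝ → ℝ}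
    (hθ : ContDiff ℝ (⊤ : ℕ∞) θ) (hρ : 0 < ρ) :
    HasDerivAt (W.smoothMass a R θ) (∫ x in closedBall a R,
      W.trace x * (deriv θ (‖x - a‖ ^ 2 / ρ ^ 2) * (-2 * ‖x - a‖ ^ 2 / ρ ^ 3)) ∂W.base) ρ := by
  have hint := W.integrableOn_trace (isCompact_closedBall a R) hR
  have hcont : Continuous θ := hθ.continuous
  have hθ' : Continuous (deriv θ) := hθ.continuous_deriv (by simp)
  -- For radii above `ρ / 2` and `x` in the ball, the argument of `deriv θ` stays in this interval,
  -- which gives an integrable bound uniform in the radius.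
  obtain ⟨C, hC⟩ := (isCompact_Icc (a := (0 : ℝ))
    (b := R ^ 2 / (ρ / 2) ^ 2)).exists_bound_of_continuousOn hθ'.continuousOn
  refine (hasDerivAt_integral_of_dominated_loc_of_deriv_le
    (F := fun r x => W.trace x * θ (‖x - a‖ ^ 2 / r ^ 2))
    (F' := fun r x => W.trace x * (deriv θ (‖x - a‖ ^ 2 / r ^ 2) * (-2 * ‖x - a‖ ^ 2 / r ^ 3)))
    (bound := fun x => |W.trace x| * (C * (2 * R ^ 2 / (ρ / 2) ^ 3)))
    (Ioi_mem_nhds (half_lt_self hρ)) ?_ ?_ ?_ ?_ ?_ ?_).2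
  · refine .of_forall fun r => hint.aestronglyMeasurable.mul ?_
    exact Continuous.aestronglyMeasurable (by fun_prop)
  · obtain ⟨D, hD⟩ := (isCompact_closedBall a R).exists_bound_of_continuousOn
      (f := fun x => θ (‖x - a‖ ^ 2 / ρ ^ 2)) (by fun_prop)
    exact Integrable.mul_bdd (c := D) hint (Continuous.aestronglyMeasurable (by fun_prop))
      (ae_restrict_of_forall_mem isClosed_closedBall.measurableSet hD)
  · exact hint.aestronglyMeasurable.mul (Continuous.aestronglyMeasurable (by fun_prop))
  · refine ae_restrict_of_forall_mem isClosed_closedBall.measurableSet fun x hx r hr => ?_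
    have hr' : ρ / 2 < r := hr
    have hr0 : 0 < ρ / 2 := half_pos hρ
    have hx' : ‖x - a‖ ^ 2 ≤ R ^ 2 := by
      rw [mem_closedBall, dist_eq_norm] at hx
      exact pow_le_pow_left₀ (norm_nonneg _) hx 2
    have h1 : ‖x - a‖ ^ 2 / r ^ 2 ≤ R ^ 2 / (ρ / 2) ^ 2 := by gcongr
    have h2 := hC _ ⟨by positivity, h1⟩
    have h3 : ‖-2 * ‖x - a‖ ^ 2 / r ^ 3‖ ≤ 2 * R ^ 2 / (ρ / 2) ^ 3 := by
      have : 0 < r := hr0.trans hr'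
      rw [neg_mul, neg_div, norm_neg, Real.norm_of_nonneg (by positivity)]
      gcongr
    rw [norm_mul, norm_mul, Real.norm_eq_abs]
    have : 0 ≤ C := (norm_nonneg _).trans h2
    gcongr
  · exact hint.abs.mul_const _
  · refine .of_forall fun x r hr => ?_
    have hr0 : r ≠ 0 := ((half_pos hρ).trans hr).ne'
    have h1 : HasDerivAt (fun r : ℝ => ‖x - a‖ ^ 2 / r ^ 2) (-2 * ‖x - a‖ ^ 2 / r ^ 3) r := by
      convert! (hasDerivAt_const r (‖x - a‖ ^ 2)).div (hasDerivAt_pow 2 r) (pow_ne_zero 2 hr0)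
        using 1
      field_simp
      simp [mul_comm]
    exact (((hθ.differentiable (by simp)) _).hasDerivAt.comp r h1).const_mul _

theorem Represents.monotoneOn_smoothMass (hW : W.Represents T) (hpos : T.IsPositive)
    (hclosed : T.IsClosed) (hR : closedBall a R ⊆ Ω) {θ : ℝ → ℝ}
    (hθ : ContDiff ℝ (⊤ : ℕ∞) θ) (h1 : ∀ s, 1 < s → θ s = 0) (hanti : Antitone θ) :
    MonotoneOn (fun ρ => W.smoothMass a R θ ρ / ρ ^ 8) (Ioo 0 R) := by
  have hder (ρ : ℝ) (hρ : ρ ∈ Ioo 0 R) := (hasDerivAt_smoothMass (W := W) hR hθ hρ.1).div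
    (hasDerivAt_pow 8 ρ) (pow_ne_zero 8 hρ.1.ne')
  refine monotoneOn_of_deriv_nonneg (convex_Ioo 0 R)
    (fun ρ hρ => (hder ρ hρ).continuousAt.continuousWithinAt)
    (fun ρ hρ => (hder ρ (interior_subset hρ)).differentiableAt.differentiableWithinAt)
    fun ρ hρ => ?_
  replace hρ := interior_subset hρ
  refine le_of_le_of_eq ?_ (hder ρ hρ).deriv.symm
  have hρ0 := hρ.1
  have hscale : ContDiff ℝ (⊤ : ℕ∞) fun s : ℝ => θ (s / ρ ^ 2) :=
    hθ.comp (contDiff_id.div_const _)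
  have hvan (s : ℝ) (hs : ρ ^ 2 < s) : θ (s / ρ ^ 2) = 0 :=
    h1 _ ((one_lt_div (by positivity)).2 hs)
  have hd (s : ℝ) : deriv (fun s : ℝ => θ (s / ρ ^ 2)) s = deriv θ (s / ρ ^ 2) / ρ ^ 2 := by
    have := ((hθ.differentiable (by simp)) (s / ρ ^ 2)).hasDerivAt.comp s
      ((hasDerivAt_id s).div_const (ρ ^ 2))
    rw [div_eq_mul_one_div]
    exact this.deriv
  have hanti' : Antitone fun s : ℝ => θ (s / ρ ^ 2) := fun s t hst =>
    hanti (div_le_div_of_nonneg_right hst (by positivity))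
  have hout (x : O2) (hx : x ∉ closedBall a R) : ρ ^ 2 < ‖x - a‖ ^ 2 := by
    rw [mem_closedBall, dist_eq_norm, not_le] at hx
    exact pow_lt_pow_left₀ (hρ.2.trans hx) hρ0.le two_ne_zero
  have hvan' := TestFunction.deriv_eq_zero_of_forall_lt hvan
  have hmain := hclosed.four_mul_le ((closedBall_subset_closedBall hρ.2.le).trans hR) hρ0.le
    hscale hvan hpos (contDiff_infty_iff_deriv.1 hscale).2 hvan' fun s => hanti'.deriv_nonpos
  rw [hW.apply_smul_one hR _ (fun x => θ (‖x - a‖ ^ 2 / ρ ^ 2))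
      (fun x => TestFunction.radial_apply ..) (fun x hx => hvan _ (hout x hx)),
    hW.apply_smul_one hR _
      (fun x => deriv (fun s : ℝ => θ (s / ρ ^ 2)) (‖x - a‖ ^ 2) * ‖x - a‖ ^ 2)
      (fun x => by rw [TestFunction.radial_apply, smul_smul])
      (fun x hx => by rw [hvan' _ (hout x hx), zero_mul])] at hmain
  -- With `χ(s) = θ(s / ρ²)` one has `χ' = θ' / ρ²`, so the radius derivative of the integrand is
  -- `-2 / ρ` times the one in `hmain`.
  have hI : ∫ x in closedBall a R,
      W.trace x * (deriv θ (‖x - a‖ ^ 2 / ρ ^ 2) * (-2 * ‖x - a‖ ^ 2 / ρ ^ 3)) ∂W.base =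
      -2 / ρ * ∫ x in closedBall a R, W.trace x *
        (deriv (fun s : ℝ => θ (s / ρ ^ 2)) (‖x - a‖ ^ 2) * ‖x - a‖ ^ 2) ∂W.base := by
    rw [← integral_const_mul]
    refine integral_congr_ae (.of_forall fun x => ?_)
    simp only [hd]
    field_simp
  rw [hI]
  change 4 * (W.smoothMass a R θ ρ / 2) ≤ _ at hmain
  refine div_nonneg ?_ (by positivity)
  generalize (∫ x in closedBall a R, W.trace x *
    (deriv (fun s : ℝ => θ (s / ρ ^ 2)) (‖x - a‖ ^ 2) * ‖x - a‖ ^ 2) ∂W.base) = J at hmain ⊢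
  -- This is the numerator of the quotient rule; `hmain` says exactly that its last factor is
  -- nonnegative.
  have : -2 / ρ * J * ρ ^ 8 - W.smoothMass a R θ ρ * (8 * ρ ^ 7) =
      2 * ρ ^ 7 * (-J - 4 * W.smoothMass a R θ ρ) := by
    field_simp
    ring
  push_cast
  rw [this]
  refine mul_nonneg (by positivity) ?_
  linarith

theorem tendsto_smoothMass (hR : closedBall a R ⊆ Ω) {r : ℝ} (hr : r ∈ Ioo 0 R) :
    Tendsto (fun n => 8 * W.smoothMass a R (profile n) r) atTop (𝓝 (W.sigma a r)) := by
  rw [sigma_eq]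
  refine Tendsto.const_mul _ ?_
  have hint := W.integrableOn_trace (isCompact_closedBall a R) hR
  have hball : ∫ x in ball a r, W.trace x ∂W.base = ∫ x in closedBall a R,
      W.trace x * (if ‖x - a‖ ^ 2 / r ^ 2 < 1 then 1 else 0) ∂W.base := by
    have hiff (x : O2) : ‖x - a‖ ^ 2 / r ^ 2 < 1 ↔ x ∈ ball a r := by
      rw [div_lt_one (pow_pos hr.1 2), mem_ball, dist_eq_norm,
        pow_lt_pow_iff_left₀ (norm_nonneg _) hr.1.le two_ne_zero]
    have hsub : ball a r ⊆ closedBall a R :=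
      ball_subset_closedBall.trans (closedBall_subset_closedBall hr.2.le)
    rw [← inter_eq_right.2 hsub, ← setIntegral_indicator isOpen_ball.measurableSet]
    refine integral_congr_ae (.of_forall fun x => ?_)
    by_cases hx : x ∈ ball a r
    · simp only [indicator_of_mem hx, if_pos ((hiff x).2 hx), mul_one]
    · simp only [indicator_of_notMem hx, if_neg (mt (hiff x).1 hx), mul_zero]
  rw [hball]
  refine tendsto_integral_of_dominated_convergence (fun x => |W.trace x|) (fun n => ?_) hint.abs
    (fun n => .of_forall fun x => ?_) (.of_forall fun x => (tendsto_profile _).const_mul _)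
  · have := (contDiff_profile n).continuous
    exact hint.aestronglyMeasurable.mul (Continuous.aestronglyMeasurable (by fun_prop))
  · rw [norm_mul, Real.norm_eq_abs, Real.norm_of_nonneg (profile_nonneg _ _)]
    exact mul_le_of_le_one_right (abs_nonneg _) (profile_le_one _ _)

/-- The smoothed trace masses are values of the current. -/
theorem exists_testFunction_smoothMass (hR : closedBall a R ⊆ Ω) {r : ℝ} (hr : r ∈ Ioo 0 R)
    (n : ℕ) : ∃ φ : 𝓓(Ω, Herm), (∀ x, (φ x).StronglyPositive) ∧
      ∀ (W : HermMeasure Ω) (T : Current Ω), W.Represents T →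
        T φ = W.smoothMass a R (profile n) r / 2 := by
  have hvan (s : ℝ) (hs : r ^ 2 < s) : profile n (s / r ^ 2) = 0 :=
    profile_eq_zero n ((one_le_div (pow_pos hr.1 2)).2 hs.le)
  refine ⟨TestFunction.radial ((closedBall_subset_closedBall hr.2.le).trans hR) hr.1.le
    (χ := fun s => profile n (s / r ^ 2)) ((contDiff_profile n).comp (contDiff_id.div_const _))
    hvan (contDiff_const (c := ((1, 0, 1) : Herm))), fun x => ?_, fun W T hW => ?_⟩
  · exact (Herm.stronglyPositive_of_sq_le zero_le_one zero_le_one (by simp)).smul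
      (profile_nonneg _ _)
  · refine hW.apply_smul_one hR _ (fun x => profile n (‖x - a‖ ^ 2 / r ^ 2)) (fun x => rfl)
      fun x hx => hvan _ ?_
    rw [mem_closedBall, dist_eq_norm, not_le] at hx
    exact pow_lt_pow_left₀ (hr.2.trans hx) hr.1.le two_ne_zero

/-- The mass of a ball is determined by the current. -/
theorem Represents.sigma_eq_sigma {W' : HermMeasure Ω} (hW : W.Represents T)
    (hW' : W'.Represents T) (hR : closedBall a R ⊆ Ω) {r : ℝ} (hr : r ∈ Ioo 0 R) :
    W.sigma a r = W'.sigma a r := by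
  refine tendsto_nhds_unique (tendsto_smoothMass hR hr)
    ((tendsto_smoothMass hR hr).congr fun n => ?_)
  obtain ⟨φ, -, hφ⟩ := exists_testFunction_smoothMass hR hr n
  have := (hφ W T hW).symm.trans (hφ W' T hW')
  linarith

/-- Positivity passes to the limit from the values of `T` on strongly positive test functions; the
sign of the trace density is never needed. -/
theorem Represents.sigma_nonneg (hW : W.Represents T) (hpos : T.IsPositive)
    (hR : closedBall a R ⊆ Ω) {r : ℝ} (hr : r ∈ Ioo 0 R) : 0 ≤ W.sigma a r := by
  refine ge_of_tendsto' (tendsto_smoothMass hR hr) fun n => ?_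
  obtain ⟨φ, hφp, hφ⟩ := exists_testFunction_smoothMass hR hr n
  have := hpos φ hφp
  rw [hφ W T hW] at this
  linarith

theorem Represents.monotoneOn_sigma (hW : W.Represents T) (hpos : T.IsPositive)
    (hclosed : T.IsClosed) (hR : closedBall a R ⊆ Ω) :
    MonotoneOn (fun r => W.sigma a r / r ^ 8) (Ioo 0 R) := by
  intro r hr s hs hrs
  refine le_of_tendsto_of_tendsto' ((tendsto_smoothMass hR hr).div_const _)
    ((tendsto_smoothMass hR hs).div_const _) fun n => ?_
  have := hW.monotoneOn_smoothMass hpos hclosed hR (contDiff_profile n)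
    (fun s hs => profile_eq_zero n hs.le) (antitone_profile n) hr hs hrs
  simp only [mul_div_assoc] at this ⊢
  linarith

end HermMeasure

end OctonionicCurrent

theorem proposition5p2 (Ω : Opens O2) (hΩ : IsConnected (Ω : Set O2))
    (a : O2) (R : ℝ) (hR : 0 < R) (hball : closedBall a R ⊆ (Ω : Set O2))
    (ω : Current Ω) (hpos : ω.IsPositive) (hclosed : ω.IsClosed) :
    -- `ω` is given by a matrix-valued Radon measure
    (∃ W : HermMeasure Ω, W.Represents ω) ∧
    -- and the function `σ(a, ·)`, which depends on `ω` only, has the stated properties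
    ∃ σ : ℝ → ℝ,
      (∀ W : HermMeasure Ω, W.Represents ω → ∀ r ∈ Ioo 0 R, W.sigma a r = σ r) ∧
      MonotoneOn (fun r => σ r / r ^ 8) (Ioo 0 R) ∧
      ∃ v : ℝ, 0 ≤ v ∧ Tendsto (fun r => σ r / r ^ 8) (𝓝[>] 0) (𝓝 v) := by
  obtain ⟨W, hW⟩ := hpos.exists_represents
  have hmono := hW.monotoneOn_sigma hpos hclosed hball
  have hnonneg (y : ℝ) (hy : y ∈ (fun r => W.sigma a r / r ^ 8) '' Ioo 0 R) : 0 ≤ y := by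
    obtain ⟨r, hr, rfl⟩ := hy
    exact div_nonneg (hW.sigma_nonneg hpos hball hr) (pow_nonneg hr.1.le 8)
  exact ⟨⟨W, hW⟩, W.sigma a, fun W' hW' r hr => hW'.sigma_eq_sigma hW hball hr, hmono,
    -- A nondecreasing quotient bounded below tends at `0+` to its infimum over `(0, R)`, which
    -- serves as the Lelong number.
    _, Real.sInf_nonneg hnonneg,
    hmono.tendsto_nhdsWithin_Ioo_right (nonempty_Ioo.2 hR) ⟨0, hnonneg⟩⟩
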